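/- **Setting.** A seller with private cost $c\sim G$ and a buyer with private value $v\sim F$ trade one item through an intermediary; $c$ and $v$ are independent. The buyer is exponential, $F(v)=1-e^{-\lambda v}$ on $[0,\infty)$ with $\lambda>0$, and $G$ is an arbitrary probability distribution on a type space $C\subseteq[0,\infty)$. An exchange mechanism assigns to each pair of actions of the seller and the buyer a trade probability $x\in[0,1]$, a payment $p_S\in\mathbb R$ to the seller and a payment $p_B\in\mathbb R$ from the buyer; utilities are $p_S-xc$ and $xv-p_B$, the intermediary's revenue is $\mathbb E[p_B-p_S]$ and the surplus is $\mathbb E[x(v-c)]$. In a Bayes–Nash equilibrium (BNE) no seller type $c\in C$ and no buyer type $v\ge 0$ can raise its interim expected utility by deviating to another action. * The *optimal revenue* $\mathrm{OPT}_{\mathrm{Rev}}$ is the supremum of the expected revenue over all exchange mechanisms and all interim individually rational BNEs of them (with finite expected payments). * The *maximum surplus* $\mathrm{OPT}_{\mathrm{Surplus}}=\mathbb E\big[(v-c)\mathbf 1\{v\ge c\}\big]$ is the expected surplus of the VCG mechanism under truthful reports. * In the *fee-setting mechanism* with constant fee $w(P)=1/\lambda$ the seller names a price $P$, which is posted to the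 buyer; if $v\ge P$ the item is traded, the buyer pays $P$, the intermediary keeps $1/\lambda$ and the seller receives $P-1/\lambda$; otherwise nothing happens. A *BNE strategy of the seller* is a map $c\mapsto P(c)$ that forms a BNE together with the buyer's rule of accepting exactly when $v\ge P$. Its expected revenue is $\mathrm{Rev}=\mathbb E\big[\tfrac1\lambda\mathbf 1\{v\ge P(c)\}\big]$. **Corollary (Exponential distribution).** The fee-setting mechanism with $w(P)=1/\lambda$ has a BNE strategy of the seller, and for every such strategy $$\mathrm{OPT}_{\mathrm{Surplus}}\le e^2\cdot \mathrm{Rev}\qquad\text{and}\qquad \mathrm{OPT}_{\mathrm{Rev}}\le e\cdot\mathrm{Rev}.$$ That is, its revenue is an $e^2$-approximation to the maximum surplus and an $e$-approximation to the optimal revenue. -/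

import Mathlib

open MeasureTheory ProbabilityTheory

noncomputable section

/-- An exchange mechanism for one seller and one buyer with action spaces `A_S` and `A_B`.
`alloc a b` is the probability that the item is traded when the seller plays `a` and the buyer
plays `b` (the seller's and the buyer's allocations agree by feasibility; deterministic mechanisms
are those with values in `{0, 1}`), `payS a b` is what the seller receives and `payB a b` is what
the buyer pays. -/
structure ExchangeMechanism (A_S A_B : Type) where
  alloc : A_S → A_B → ℝ
  alloc_nonneg : ∀ a b, 0 ≤ alloc a b
  alloc_le_one : ∀ a b, alloc a b ≤ 1
  payS : A_S → A_B → ℝ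
  payB : A_S → A_B → ℝ

/-- The common prior: the cost `c` of the seller has law `G` and type space `C`, the value `v` of
the buyer has law `F` and type space `V`, and `c`, `v` are independent, so that `(c, v)` has law
`G.prod F`. -/
structure ExchangeSetting where
  F : Measure ℝ
  V : Set ℝ
  G : Measure ℝ
  C : Set ℝ

namespace ExchangeMechanism

variable {A_S A_B : Type}

/-- Interim expected utility of a seller with cost `c` who plays the action `a`, when the buyer
uses the strategy `bB`. -/
def sellerUtility (M : ExchangeMechanism A_S A_B) (E : ExchangeSetting) (bB : ℝ → A_B)
    (c : ℝ) (a : A_S) : ℝ :=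
  ∫ v, (M.payS a (bB v) - M.alloc a (bB v) * c) ∂E.F

/-- Interim expected utility of a buyer with value `v` who plays the action `b`, when the seller
uses the strategy `bS`. -/
def buyerUtility (M : ExchangeMechanism A_S A_B) (E : ExchangeSetting) (bS : ℝ → A_S)
    (v : ℝ) (b : A_B) : ℝ :=
  ∫ c, (M.alloc (bS c) b * v - M.payB (bS c) b) ∂E.G

/-- Bayes-Nash equilibrium: no type of either agent gains by a deviation to another action. -/
def IsBNE (M : ExchangeMechanism A_S A_B) (E : ExchangeSetting)
    (bS : ℝ → A_S) (bB : ℝ → A_B) : Prop :=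
  (∀ c ∈ E.C, ∀ a : A_S, M.sellerUtility E bB c a ≤ M.sellerUtility E bB c (bS c)) ∧
  (∀ v ∈ E.V, ∀ b : A_B, M.buyerUtility E bS v b ≤ M.buyerUtility E bS v (bB v))

/-- Interim individual rationality of the strategy profile `(bS, bB)`. -/
def IsInterimIR (M : ExchangeMechanism A_S A_B) (E : ExchangeSetting)
    (bS : ℝ → A_S) (bB : ℝ → A_B) : Prop :=
  (∀ c ∈ E.C, 0 ≤ M.sellerUtility E bB c (bS c)) ∧
  (∀ v ∈ E.V, 0 ≤ M.buyerUtility E bS v (bB v))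

/-- All ex-ante and interim expected allocations and payments of the strategy profile exist. -/
structure HasExpectations (M : ExchangeMechanism A_S A_B) (E : ExchangeSetting)
    (bS : ℝ → A_S) (bB : ℝ → A_B) : Prop where
  alloc : Integrable (fun t : ℝ × ℝ => M.alloc (bS t.1) (bB t.2)) (E.G.prod E.F)
  payS : Integrable (fun t : ℝ × ℝ => M.payS (bS t.1) (bB t.2)) (E.G.prod E.F)
  payB : Integrable (fun t : ℝ × ℝ => M.payB (bS t.1) (bB t.2)) (E.G.prod E.F)
  alloc_seller : ∀ c ∈ E.C, Integrable (fun v => M.alloc (bS c) (bB v)) E.F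
  payS_seller : ∀ c ∈ E.C, Integrable (fun v => M.payS (bS c) (bB v)) E.F
  alloc_buyer : ∀ v ∈ E.V, Integrable (fun c => M.alloc (bS c) (bB v)) E.G
  payB_buyer : ∀ v ∈ E.V, Integrable (fun c => M.payB (bS c) (bB v)) E.G

/-- Expected revenue of the intermediary under the strategy profile `(bS, bB)`. -/
def revenue (M : ExchangeMechanism A_S A_B) (E : ExchangeSetting)
    (bS : ℝ → A_S) (bB : ℝ → A_B) : ℝ :=
  ∫ t : ℝ × ℝ, (M.payB (bS t.1) (bB t.2) - M.payS (bS t.1) (bB t.2)) ∂(E.G.prod E.F)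

/-- Expected surplus (gains from trade) under the strategy profile `(bS, bB)`. -/
def surplus (M : ExchangeMechanism A_S A_B) (E : ExchangeSetting)
    (bS : ℝ → A_S) (bB : ℝ → A_B) : ℝ :=
  ∫ t : ℝ × ℝ, M.alloc (bS t.1) (bB t.2) * (t.2 - t.1) ∂(E.G.prod E.F)

end ExchangeMechanism

/-- The optimal revenue: the supremum of the expected revenues over all exchange mechanisms and
all interim individually rational Bayes-Nash equilibria of them. -/
def optRevenue (E : ExchangeSetting) : EReal :=
  sSup {r : EReal | ∃ (A_S A_B : Type) (M : ExchangeMechanism A_S A_B)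
    (bS : ℝ → A_S) (bB : ℝ → A_B), M.HasExpectations E bS bB ∧ M.IsBNE E bS bB ∧
      M.IsInterimIR E bS bB ∧ r = ((M.revenue E bS bB : ℝ) : EReal)}

/-- The Vickrey-Clarke-Groves mechanism: the agents report `c` and `v`; if `c ≤ v` the item is
traded, the seller is paid `v` and the buyer is charged `c`. -/
def vcg : ExchangeMechanism ℝ ℝ where
  alloc c v := if c ≤ v then 1 else 0
  alloc_nonneg c v := by split_ifs <;> norm_num
  alloc_le_one c v := by split_ifs <;> norm_num
  payS c v := if c ≤ v then v else 0
  payB c v := if c ≤ v then c else 0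

/-- The maximum surplus: the expected surplus of the VCG mechanism under truthful reports. -/
def optSurplus (E : ExchangeSetting) : ℝ := vcg.surplus E id id

/-- The fee-setting mechanism with fee schedule `w`: the seller names a price `P`, which is posted
to the buyer; if the buyer's reported value `v` is at least `P`, the item is traded, the buyer
pays `P`, the intermediary keeps `w P` and the seller receives `P - w P`. -/
def feeSetting (w : ℝ → ℝ) : ExchangeMechanism ℝ ℝ where
  alloc P v := if P ≤ v then 1 else 0
  alloc_nonneg P v := by split_ifs <;> norm_num
  alloc_le_one P v := by split_ifs <;> norm_num
  payS P v := if P ≤ v then P - w P else 0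
  payB P v := if P ≤ v then P else 0

/-- The affine fee-setting mechanism with fee schedule `w P = (1 - α) * P + β`. -/
def APX (α β : ℝ) : ExchangeMechanism ℝ ℝ := feeSetting fun P => (1 - α) * P + β

/-- `P` is a Bayes-Nash equilibrium strategy of the seller in `APX α β`; the buyer accepts the
posted price exactly when it is at most his value, that is, he plays the identity strategy. -/
def IsSellerBNE (α β : ℝ) (E : ExchangeSetting) (P : ℝ → ℝ) : Prop :=
  (APX α β).IsBNE E P id

/-- The expected revenue of `APX α β` when the seller uses the pricing strategy `P`. -/
def revAPX (α β : ℝ) (E : ExchangeSetting) (P : ℝ → ℝ) : ℝ :=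
  (APX α β).revenue E P id

end

/-! Everything reduces to the expected excess `E[(v - c - a/λ)⁺]`. By memorylessness, given `c` it
equals `exp(-λc - a) / λ`, so raising `a` by one costs exactly a factor `e`, whatever the law of
`c`.

The maximum surplus is the case `a = 0`. The optimal revenue is at most the case `a = 1`: the
buyer's virtual value is `v - 1/λ`, and individual rationality makes payments to the seller cover at
least the expected cost (`revenue_le_integral_excess`). Facing the fee `1/λ`, the seller's unique
best price is `c + 2/λ` (`mul_exp_neg_lt_of_ne`), so the fee revenue is `E[exp(-λc - 2)] / λ`, the
case `a = 2`. The gaps 2 and 1 give the factors `e²` and `e`. -/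

/-! ### Tails, memorylessness and integrals of the exponential law. -/

/-- Since the cdf vanishes at 0, monotonicity forces it to vanish on the negative axis; `max a 0`
covers both ranges. Continuity excludes atoms, so closed half-lines cause no correction. -/
theorem measure_Ici_of_cdf_eq_exp {lam : ℝ} (F : Measure ℝ)
    [IsProbabilityMeasure F] (hF : ∀ v : ℝ, 0 ≤ v → cdf F v = 1 - Real.exp (-lam * v)) (a : ℝ) :
    F (Set.Ici a) = ENNReal.ofReal (Real.exp (-lam * max a 0)) := by
  have hcdf : ∀ v, cdf F v = 1 - Real.exp (-lam * max v 0) := by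
    intro v
    rcases le_total 0 v with hv | hv
    · rw [max_eq_left hv, hF v hv]
    · have h0 := hF 0 le_rfl
      have h1 := monotone_cdf F hv
      have h2 := cdf_nonneg F v
      rw [max_eq_right hv]
      simp only [mul_zero, Real.exp_zero, sub_self] at h0 ⊢
      linarith
  have hcont : Continuous (cdf F) := by
    have : (cdf F : ℝ → ℝ) = fun v => 1 - Real.exp (-lam * max v 0) := funext hcdf
    rw [this]
    fun_prop
  conv_lhs => rw [← measure_cdf F]
  rw [(cdf F).measure_Ici (tendsto_cdf_atTop F),
    hcont.continuousWithinAt.leftLim_eq, hcdf, sub_sub_cancel]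

theorem measureReal_Ici_of_exponential_tail {lam : ℝ} {F : Measure ℝ}
    (hT : ∀ a, F (Set.Ici a) = ENNReal.ofReal (Real.exp (-lam * max a 0))) (a : ℝ) :
    F.real (Set.Ici a) = Real.exp (-lam * max a 0) := by
  rw [measureReal_def, hT, ENNReal.toReal_ofReal (Real.exp_pos _).le]

section Exponential

variable {lam : ℝ} {F : Measure ℝ} [IsProbabilityMeasure F]

theorem ae_nonneg_of_exponential_tail
    (hT : ∀ a, F (Set.Ici a) = ENNReal.ofReal (Real.exp (-lam * max a 0))) :
    ∀ᵐ v ∂F, 0 ≤ v := by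
  have h : F (Set.Ici 0) = 1 := by simp [hT]
  exact (mem_ae_iff_prob_eq_one measurableSet_Ici).2 h

/-- Memorylessness of the exponential distribution. -/
theorem restrict_Ici_of_exponential_tail
    (hT : ∀ a, F (Set.Ici a) = ENNReal.ofReal (Real.exp (-lam * max a 0))) {h : ℝ} (hh : 0 ≤ h) :
    F.restrict (Set.Ici h) = ENNReal.ofReal (Real.exp (-lam * h)) • F.map (· + h) := by
  have : IsProbabilityMeasure (F.map (· + h)) :=
    Measure.isProbabilityMeasure_map (by fun_prop)
  refine Measure.ext_of_Ici _ _ fun a => ?_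
  rw [Measure.restrict_apply measurableSet_Ici, Set.Ici_inter_Ici, Measure.smul_apply,
    Measure.map_apply (by fun_prop) measurableSet_Ici]
  have : (fun x : ℝ => x + h) ⁻¹' Set.Ici a = Set.Ici (a - h) := by
    ext x; simp
  rw [this, hT, hT, smul_eq_mul, ← ENNReal.ofReal_mul (Real.exp_pos _).le, ← Real.exp_add]
  congr 2
  change -lam * max (max a h) 0 = _
  rw [max_eq_left (hh.trans (le_max_right a h))]
  rcases le_total a h with hah | hah
  · rw [max_eq_right hah, max_eq_right (by linarith)]; ring
  · rw [max_eq_left hah, max_eq_left (by linarith)]; ring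

theorem lintegral_id_of_exponential_tail (hlam : 0 < lam)
    (hT : ∀ a, F (Set.Ici a) = ENNReal.ofReal (Real.exp (-lam * max a 0))) :
    ∫⁻ v, ENNReal.ofReal v ∂F = ENNReal.ofReal (1 / lam) := by
  rw [lintegral_eq_lintegral_meas_le F (ae_nonneg_of_exponential_tail hT) (by fun_prop)]
  have h1 : ∫⁻ t in Set.Ioi (0 : ℝ), F {a : ℝ | t ≤ a}
      = ∫⁻ t in Set.Ioi (0 : ℝ), ENNReal.ofReal (Real.exp (-lam * t)) := by
    refine setLIntegral_congr_fun measurableSet_Ioi fun t ht => ?_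
    have := hT t
    rw [max_eq_left (le_of_lt ht)] at this
    exact this
  rw [h1, ← ofReal_integral_eq_lintegral_ofReal
    (integrableOn_exp_mul_Ioi (neg_lt_zero.2 hlam) 0)
    (Filter.Eventually.of_forall fun _ => (Real.exp_pos _).le),
    integral_exp_mul_Ioi (neg_lt_zero.2 hlam) 0]
  simp

theorem integrable_id_of_exponential_tail (hlam : 0 < lam)
    (hT : ∀ a, F (Set.Ici a) = ENNReal.ofReal (Real.exp (-lam * max a 0))) :
    Integrable (fun v : ℝ => v) F := by
  refine ⟨by fun_prop, ?_⟩
  rw [hasFiniteIntegral_iff_ofReal (ae_nonneg_of_exponential_tail hT),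
    lintegral_id_of_exponential_tail hlam hT]
  exact ENNReal.ofReal_lt_top

theorem integral_id_of_exponential_tail (hlam : 0 < lam)
    (hT : ∀ a, F (Set.Ici a) = ENNReal.ofReal (Real.exp (-lam * max a 0))) :
    ∫ v, v ∂F = 1 / lam := by
  rw [integral_eq_lintegral_of_nonneg_ae (ae_nonneg_of_exponential_tail hT) (by fun_prop),
    lintegral_id_of_exponential_tail hlam hT, ENNReal.toReal_ofReal (by positivity)]

/-- Given `v ≥ h`, the excess `v - h` is again exponential: the tail probability multiplies the mean
`1/λ`. -/
theorem integral_excess_of_exponential_tail (hlam : 0 < lam)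
    (hT : ∀ a, F (Set.Ici a) = ENNReal.ofReal (Real.exp (-lam * max a 0))) {h : ℝ} (hh : 0 ≤ h) :
    ∫ v, max (v - h) 0 ∂F = Real.exp (-lam * h) / lam := by
  have h1 : ∀ v : ℝ, max (v - h) 0 = (Set.Ici h).indicator (fun v => v - h) v := by
    intro v
    by_cases hv : h ≤ v
    · rw [Set.indicator_of_mem (by simpa using hv), max_eq_left (by linarith)]
    · rw [Set.indicator_of_notMem (by simpa using hv), max_eq_right (by linarith)]
  simp_rw [h1]
  rw [integral_indicator measurableSet_Ici, restrict_Ici_of_exponential_tail hT hh,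
    integral_smul_measure, integral_map (by fun_prop) (by fun_prop)]
  simp only [add_sub_cancel_right]
  rw [integral_id_of_exponential_tail hlam hT, ENNReal.toReal_ofReal (Real.exp_pos _).le,
    smul_eq_mul, mul_one_div]

/-- By memorylessness the shifted law is the restriction to `[h, ∞)` rescaled by `exp(λh)`. This
domination transfers integrability and bounds of nonnegative functions under shifts. -/
theorem map_add_le_of_exponential_tail
    (hT : ∀ a, F (Set.Ici a) = ENNReal.ofReal (Real.exp (-lam * max a 0))) {h : ℝ} (hh : 0 ≤ h) :
    F.map (· + h) ≤ ENNReal.ofReal (Real.exp (lam * h)) • F := by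
  have h1 : F.map (· + h) = ENNReal.ofReal (Real.exp (lam * h)) • F.restrict (Set.Ici h) := by
    rw [restrict_Ici_of_exponential_tail hT hh, smul_smul,
      ← ENNReal.ofReal_mul (Real.exp_pos _).le, ← Real.exp_add]
    simp
  rw [h1]
  gcongr
  exact Measure.restrict_le_self

theorem integrable_comp_add_of_exponential_tail
    (hT : ∀ a, F (Set.Ici a) = ENNReal.ofReal (Real.exp (-lam * max a 0))) {h : ℝ} (hh : 0 ≤ h)
    {u : ℝ → ℝ} (hu : Integrable u F) : Integrable (fun v => u (v + h)) F :=
  ((hu.smul_measure ENNReal.ofReal_ne_top).mono_measure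
    (map_add_le_of_exponential_tail hT hh)).comp_measurable (by fun_prop)

theorem integral_comp_add_le_of_exponential_tail
    (hT : ∀ a, F (Set.Ici a) = ENNReal.ofReal (Real.exp (-lam * max a 0))) {h : ℝ} (hh : 0 ≤ h)
    {u : ℝ → ℝ} (hu : Integrable u F) (hu0 : ∀ v, 0 ≤ v → 0 ≤ u v) :
    ∫ v, u (v + h) ∂F ≤ Real.exp (lam * h) * ∫ v, u v ∂F := by
  have hle := map_add_le_of_exponential_tail hT hh
  have hi : Integrable u (ENNReal.ofReal (Real.exp (lam * h)) • F) :=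
    hu.smul_measure ENNReal.ofReal_ne_top
  have h1 : ∫ v, u (v + h) ∂F = ∫ v, u v ∂(F.map (· + h)) :=
    (integral_map (by fun_prop) (hi.mono_measure hle).aestronglyMeasurable).symm
  rw [h1]
  refine (integral_mono_measure hle ?_ hi).trans_eq ?_
  · have hnn : ∀ᵐ v ∂F, 0 ≤ u v := by
      filter_upwards [ae_nonneg_of_exponential_tail hT] with v hv using hu0 v hv
    exact Measure.ae_smul_measure hnn _
  · rw [integral_smul_measure, ENNReal.toReal_ofReal (Real.exp_pos _).le, smul_eq_mul]

/-- If `x` is a subgradient of the nonnegative function `u`, then the expectation of `u` under the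
exponential distribution is at least the expectation of `x` times the mean. -/
theorem integral_subgradient_le_of_exponential_tail
    (hT : ∀ a, F (Set.Ici a) = ENNReal.ofReal (Real.exp (-lam * max a 0)))
    {u x : ℝ → ℝ} (hu : Integrable u F) (hx : Integrable x F) (hu0 : ∀ v, 0 ≤ v → 0 ≤ u v)
    (hsub : ∀ v w, 0 ≤ v → 0 ≤ w → u v + (w - v) * x v ≤ u w) :
    ∫ v, x v ∂F ≤ lam * ∫ v, u v ∂F := by
  -- A difference quotient replaces integration by parts, so no differentiability of `u` is needed:
  -- `E u + h E x ≤ E u(v + h) ≤ exp(λh) E u`. Dividing by `h` and letting `h → 0⁺` leaves the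
  -- derivative `λ` of `exp(λh)` at 0.
  have key : ∀ h : ℝ, 0 < h → ∫ v, x v ∂F ≤ h⁻¹ * (Real.exp (lam * h) - 1) * ∫ v, u v ∂F := by
    intro h hh
    have h1 : ∫ v, (u v + h * x v) ∂F ≤ ∫ v, u (v + h) ∂F := by
      refine integral_mono_ae (hu.add (hx.const_mul h))
        (integrable_comp_add_of_exponential_tail hT hh.le hu) ?_
      filter_upwards [ae_nonneg_of_exponential_tail hT] with v hv
      have := hsub v (v + h) hv (by linarith)
      rwa [add_sub_cancel_left] at this
    rw [integral_add hu (hx.const_mul h), integral_const_mul] at h1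
    have h2 := integral_comp_add_le_of_exponential_tail hT hh.le hu hu0
    rw [mul_assoc, ← div_eq_inv_mul, le_div_iff₀ hh]
    linarith
  have hd : HasDerivAt (fun h : ℝ => Real.exp (lam * h)) lam 0 := by
    simpa using ((hasDerivAt_id (0 : ℝ)).const_mul lam).exp
  have ht := (hd.tendsto_slope_zero_right).mul_const (∫ v, u v ∂F)
  refine ge_of_tendsto ht ?_
  filter_upwards [self_mem_nhdsWithin] with h hh
  simpa using key h hh

end Exponential

/-! ### Equilibrium prices under the constant fee. -/

/-- This is `t + 1 < exp t` at `t = λ(p - 1/λ - c) - 1`, which vanishes only at `p = c + 2/λ`. A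
price `p ≤ 0` always sells, but at a loss. Strictness makes the best response unique, which controls
every equilibrium. -/
theorem mul_exp_neg_lt_of_ne {lam : ℝ} (hlam : 0 < lam) {c p : ℝ} (hc : 0 ≤ c)
    (hp : p ≠ c + 2 / lam) :
    (p - 1 / lam - c) * Real.exp (-lam * max p 0) < 1 / lam * Real.exp (-lam * (c + 2 / lam)) := by
  rcases le_total 0 p with h0 | h0
  · rw [max_eq_left h0]
    have hne : lam * (p - 1 / lam - c) - 1 ≠ 0 := by
      intro h
      apply hp
      field_simp at h ⊢
      linarith
    have h1 := Real.add_one_lt_exp hne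
    rw [sub_add_cancel] at h1
    have h2 : Real.exp (-lam * (c + 2 / lam))
        = Real.exp (lam * (p - 1 / lam - c) - 1) * Real.exp (-lam * p) := by
      rw [← Real.exp_add]
      congr 1
      field_simp
      ring
    rw [h2, ← mul_assoc]
    refine mul_lt_mul_of_pos_right ?_ (Real.exp_pos _)
    rwa [one_div_mul_eq_div, lt_div_iff₀ hlam, mul_comm]
  · have hl : 0 < 1 / lam := by positivity
    exact lt_of_le_of_lt (mul_nonpos_of_nonpos_of_nonneg (by linarith) (Real.exp_pos _).le)
      (by positivity)

section FeeSetting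

variable {lam : ℝ} {F G : Measure ℝ} {C : Set ℝ}

theorem APX_sellerUtility_of_exponential_tail [IsProbabilityMeasure F]
    (hT : ∀ a, F (Set.Ici a) = ENNReal.ofReal (Real.exp (-lam * max a 0)))
    (V : Set ℝ) (c p : ℝ) :
    (APX 1 (1 / lam)).sellerUtility ⟨F, V, G, C⟩ id c p
      = (p - 1 / lam - c) * Real.exp (-lam * max p 0) := by
  have h : ∀ v : ℝ, (APX 1 (1 / lam)).payS p (id v) - (APX 1 (1 / lam)).alloc p (id v) * c
      = (Set.Ici p).indicator (fun _ => p - 1 / lam - c) v := by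
    intro v
    simp only [APX, feeSetting, Set.indicator, Set.mem_Ici, id]
    split_ifs <;> ring
  simp only [ExchangeMechanism.sellerUtility]
  simp_rw [h]
  rw [integral_indicator_const _ measurableSet_Ici, measureReal_Ici_of_exponential_tail hT,
    smul_eq_mul, mul_comm]

theorem APX_sellerUtility_best_response [IsProbabilityMeasure F] (hlam : 0 < lam)
    (hT : ∀ a, F (Set.Ici a) = ENNReal.ofReal (Real.exp (-lam * max a 0)))
    (V : Set ℝ) {c : ℝ} (hc : 0 ≤ c) :
    (APX 1 (1 / lam)).sellerUtility ⟨F, V, G, C⟩ id c (c + 2 / lam)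
      = 1 / lam * Real.exp (-lam * (c + 2 / lam)) := by
  rw [APX_sellerUtility_of_exponential_tail hT, max_eq_left (by positivity)]
  congr 1
  ring

theorem eq_add_of_isSellerBNE [IsProbabilityMeasure F] (hlam : 0 < lam)
    (hT : ∀ a, F (Set.Ici a) = ENNReal.ofReal (Real.exp (-lam * max a 0)))
    (hC : C ⊆ Set.Ici 0) {V : Set ℝ} {P : ℝ → ℝ}
    (hP : IsSellerBNE 1 (1 / lam) ⟨F, V, G, C⟩ P) {c : ℝ} (hc : c ∈ C) :
    P c = c + 2 / lam := by
  by_contra hne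
  have h := hP.1 c hc (c + 2 / lam)
  rw [APX_sellerUtility_best_response hlam hT V (hC hc),
    APX_sellerUtility_of_exponential_tail hT] at h
  exact absurd h (not_le.2 (mul_exp_neg_lt_of_ne hlam (hC hc) hne))

/-- The buyer's report never affects the price, so truthful acceptance is optimal for each cost
separately. -/
theorem isSellerBNE_add [IsProbabilityMeasure F] [IsProbabilityMeasure G] (hlam : 0 < lam)
    (hT : ∀ a, F (Set.Ici a) = ENNReal.ofReal (Real.exp (-lam * max a 0)))
    (hC : C ⊆ Set.Ici 0) (hG : ∀ᵐ c ∂G, c ∈ C) (V : Set ℝ) :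
    IsSellerBNE 1 (1 / lam) ⟨F, V, G, C⟩ fun c => c + 2 / lam := by
  refine ⟨fun c hc p => ?_, fun v _ b => ?_⟩
  · rw [APX_sellerUtility_best_response hlam hT V (hC hc)]
    by_cases hp : p = c + 2 / lam
    · rw [hp, APX_sellerUtility_best_response hlam hT V (hC hc)]
    · rw [APX_sellerUtility_of_exponential_tail hT]
      exact (mul_exp_neg_lt_of_ne hlam (hC hc) hp).le
  · have hl : 0 < 2 / lam := by positivity
    have hform : ∀ b c : ℝ, (APX 1 (1 / lam)).alloc (c + 2 / lam) b * v
        - (APX 1 (1 / lam)).payB (c + 2 / lam) b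
        = (Set.Iic (b - 2 / lam)).indicator (fun c => v - (c + 2 / lam)) c := by
      intro b c
      simp only [APX, feeSetting, Set.indicator, Set.mem_Iic, le_sub_iff_add_le]
      split_ifs <;> ring
    -- The law `G` may have no mean, but trade at report `b` requires a price of at most `b`, so the
    -- buyer's payoff is bounded by `|v| + |b|`.
    have hint : ∀ b : ℝ, Integrable
        ((Set.Iic (b - 2 / lam)).indicator fun c => v - (c + 2 / lam)) G := by
      intro b
      refine Integrable.of_bound
        (Measurable.indicator (by fun_prop) measurableSet_Iic).aestronglyMeasurable (|v| + |b|) ?_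
      filter_upwards [hG] with c hc
      have hc0 : 0 ≤ c := hC hc
      by_cases hcb : c ∈ Set.Iic (b - 2 / lam)
      · rw [Set.indicator_of_mem hcb, Real.norm_eq_abs]
        have hcb' : c + 2 / lam ≤ b := by simpa [le_sub_iff_add_le] using hcb
        refine (abs_sub _ _).trans (add_le_add le_rfl ?_)
        rw [abs_of_nonneg (by linarith)]
        exact hcb'.trans (le_abs_self b)
      · rw [Set.indicator_of_notMem hcb, norm_zero]
        positivity
    simp only [ExchangeMechanism.buyerUtility, id]
    simp_rw [hform]
    refine integral_mono (hint b) (hint v) fun c => ?_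
    simp only [Set.indicator, Set.mem_Iic, le_sub_iff_add_le]
    split_ifs <;> linarith

/-! ### Surplus and revenues as expected excesses. -/

/-- The summand `0` puts the surplus in the form of `integral_prod_excess` with `a = 0`. -/
theorem optSurplus_eq_integral_excess (V : Set ℝ) :
    optSurplus ⟨F, V, G, C⟩ = ∫ t : ℝ × ℝ, max (t.2 - (t.1 + 0)) 0 ∂(G.prod F) := by
  refine integral_congr_ae (Filter.Eventually.of_forall fun t => ?_)
  simp only [vcg, id, add_zero]
  split_ifs with h
  · rw [max_eq_left (by linarith), one_mul]
  · rw [max_eq_right (by linarith), zero_mul]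

variable [IsProbabilityMeasure F] [IsProbabilityMeasure G]

theorem revAPX_eq_of_isSellerBNE (hlam : 0 < lam)
    (hT : ∀ a, F (Set.Ici a) = ENNReal.ofReal (Real.exp (-lam * max a 0)))
    (hC : C ⊆ Set.Ici 0) (hG : ∀ᵐ c ∂G, c ∈ C) {V : Set ℝ} {P : ℝ → ℝ}
    (hP : IsSellerBNE 1 (1 / lam) ⟨F, V, G, C⟩ P) :
    revAPX 1 (1 / lam) ⟨F, V, G, C⟩ P = ∫ c, Real.exp (-lam * (c + 2 / lam)) / lam ∂G := by
  have hS : MeasurableSet {t : ℝ × ℝ | t.1 + 2 / lam ≤ t.2} :=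
    measurableSet_le (by fun_prop) (by fun_prop)
  have h1 : revAPX 1 (1 / lam) ⟨F, V, G, C⟩ P
      = ∫ t, {t : ℝ × ℝ | t.1 + 2 / lam ≤ t.2}.indicator (fun _ => 1 / lam) t ∂(G.prod F) := by
    refine integral_congr_ae ?_
    -- Equilibrium determines `P` only on `C`, which carries almost all of `G`.
    filter_upwards [Measure.quasiMeasurePreserving_fst.ae hG] with t ht
    simp only [eq_add_of_isSellerBNE hlam hT hC hP ht, APX, feeSetting, Set.indicator,
      Set.mem_ofPred_eq, id]
    split_ifs <;> ring
  rw [h1, integral_prod _ ((integrable_const _).indicator hS)]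
  refine integral_congr_ae ?_
  filter_upwards [hG] with c hc
  have h2 : ∀ v : ℝ, {t : ℝ × ℝ | t.1 + 2 / lam ≤ t.2}.indicator (fun _ => 1 / lam) (c, v)
      = (Set.Ici (c + 2 / lam)).indicator (fun _ => 1 / lam) v := fun v => rfl
  have hc0 : 0 ≤ c := hC hc
  simp_rw [h2]
  rw [integral_indicator_const _ measurableSet_Ici, measureReal_Ici_of_exponential_tail hT,
    max_eq_left (by positivity), smul_eq_mul, mul_one_div]

theorem integrable_prod_excess (hlam : 0 < lam)
    (hT : ∀ a, F (Set.Ici a) = ENNReal.ofReal (Real.exp (-lam * max a 0)))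
    (hG : ∀ᵐ c ∂G, 0 ≤ c) {a : ℝ} (ha : 0 ≤ a) :
    Integrable (fun t : ℝ × ℝ => max (t.2 - (t.1 + a)) 0) (G.prod F) := by
  refine ((integrable_id_of_exponential_tail hlam hT).comp_snd G).mono' (by fun_prop) ?_
  filter_upwards [Measure.quasiMeasurePreserving_fst.ae hG,
    Measure.quasiMeasurePreserving_snd.ae (ae_nonneg_of_exponential_tail hT)] with t h1 h2
  rw [Real.norm_of_nonneg (le_max_right _ _)]
  exact max_le (by linarith) h2

theorem integral_prod_excess (hlam : 0 < lam)
    (hT : ∀ a, F (Set.Ici a) = ENNReal.ofReal (Real.exp (-lam * max a 0)))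
    (hG : ∀ᵐ c ∂G, 0 ≤ c) {a : ℝ} (ha : 0 ≤ a) :
    ∫ t : ℝ × ℝ, max (t.2 - (t.1 + a)) 0 ∂(G.prod F)
      = ∫ c, Real.exp (-lam * (c + a)) / lam ∂G := by
  rw [integral_prod _ (integrable_prod_excess hlam hT hG ha)]
  refine integral_congr_ae ?_
  filter_upwards [hG] with c hc
  exact integral_excess_of_exponential_tail hlam hT (by positivity)

/-- Virtual-surplus bound: the revenue of any individually rational equilibrium is at most the
expected positive part of the buyer's virtual value `v - 1 / lam` minus the seller's cost. -/
theorem revenue_le_integral_excess (hlam : 0 < lam)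
    (hT : ∀ a, F (Set.Ici a) = ENNReal.ofReal (Real.exp (-lam * max a 0)))
    (hC : C ⊆ Set.Ici 0) (hG : ∀ᵐ c ∂G, c ∈ C) {A_S A_B : Type}
    (M : ExchangeMechanism A_S A_B) {bS : ℝ → A_S} {bB : ℝ → A_B}
    (hE : M.HasExpectations ⟨F, Set.Ici 0, G, C⟩ bS bB)
    (hB : M.IsBNE ⟨F, Set.Ici 0, G, C⟩ bS bB) (hI : M.IsInterimIR ⟨F, Set.Ici 0, G, C⟩ bS bB) :
    M.revenue ⟨F, Set.Ici 0, G, C⟩ bS bB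
      ≤ ∫ t : ℝ × ℝ, max (t.2 - (t.1 + 1 / lam)) 0 ∂(G.prod F) := by
  have hF0 := ae_nonneg_of_exponential_tail hT
  have hG0 : ∀ᵐ c ∂G, 0 ≤ c := hG.mono fun c hc => hC hc
  have hX : Integrable (fun t : ℝ × ℝ => M.alloc (bS t.1) (bB t.2)) (G.prod F) := hE.alloc
  have hpS : Integrable (fun t : ℝ × ℝ => M.payS (bS t.1) (bB t.2)) (G.prod F) := hE.payS
  have hpB : Integrable (fun t : ℝ × ℝ => M.payB (bS t.1) (bB t.2)) (G.prod F) := hE.payB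
  -- The seller: expected payments cover expected costs.
  have hS : ∀ c ∈ C, (∫ v, M.alloc (bS c) (bB v) ∂F) * c ≤ ∫ v, M.payS (bS c) (bB v) ∂F := by
    intro c hc
    have h := hI.1 c hc
    have h1 : Integrable (fun v => M.alloc (bS c) (bB v)) F := hE.alloc_seller c hc
    have h2 : Integrable (fun v => M.payS (bS c) (bB v)) F := hE.payS_seller c hc
    simp only [ExchangeMechanism.sellerUtility] at h
    rw [integral_sub h2 (h1.mul_const c), integral_mul_const] at h
    linarith
  -- The cost itself need not be integrable under `G`. Individual rationality bounds the interim
  -- expected cost by the interim payment, which is integrable.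
  have hXc : Integrable (fun t : ℝ × ℝ => M.alloc (bS t.1) (bB t.2) * t.1) (G.prod F) := by
    have hm : AEStronglyMeasurable (fun t : ℝ × ℝ => M.alloc (bS t.1) (bB t.2) * t.1)
        (G.prod F) := hX.aestronglyMeasurable.mul measurable_fst.aestronglyMeasurable
    rw [integrable_prod_iff hm]
    constructor
    · filter_upwards [hG] with c hc
      exact Integrable.mul_const (hE.alloc_seller c hc) c
    · refine hpS.integral_prod_left.mono' hm.norm.integral_prod_right' ?_
      filter_upwards [hG] with c hc
      have hc0 : 0 ≤ c := hC hc
      rw [Real.norm_of_nonneg (integral_nonneg fun v => norm_nonneg _)]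
      refine le_trans (le_of_eq ?_) (hS c hc)
      rw [← integral_mul_const]
      exact integral_congr_ae (Filter.Eventually.of_forall fun v =>
        Real.norm_of_nonneg (mul_nonneg (M.alloc_nonneg _ _) hc0))
  have hseller : ∫ t : ℝ × ℝ, M.alloc (bS t.1) (bB t.2) * t.1 ∂(G.prod F)
      ≤ ∫ t : ℝ × ℝ, M.payS (bS t.1) (bB t.2) ∂(G.prod F) := by
    rw [integral_prod _ hXc, integral_prod _ hpS]
    refine integral_mono_ae hXc.integral_prod_left hpS.integral_prod_left ?_
    filter_upwards [hG] with c hc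
    simpa only [integral_mul_const] using hS c hc
  -- The buyer: the interim utility has the interim allocation as a subgradient.
  have hXv : Integrable (fun t : ℝ × ℝ => M.alloc (bS t.1) (bB t.2) * t.2) (G.prod F) := by
    refine ((integrable_id_of_exponential_tail hlam hT).comp_snd G).mono'
      (hX.aestronglyMeasurable.mul measurable_snd.aestronglyMeasurable) ?_
    filter_upwards [Measure.quasiMeasurePreserving_snd.ae hF0] with t ht
    rw [Real.norm_of_nonneg (mul_nonneg (M.alloc_nonneg _ _) ht)]
    exact mul_le_of_le_one_left ht (M.alloc_le_one _ _)
  have hU := hXv.sub hpB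
  have hbuyer := integral_subgradient_le_of_exponential_tail hT
    (u := fun v => ∫ c, (M.alloc (bS c) (bB v) * v - M.payB (bS c) (bB v)) ∂G)
    (x := fun v => ∫ c, M.alloc (bS c) (bB v) ∂G)
    hU.integral_prod_right hX.integral_prod_right (fun v hv => hI.2 v hv) (by
      intro v w hv hw
      have h1 : Integrable (fun c => M.alloc (bS c) (bB v)) G := hE.alloc_buyer v hv
      have h2 : Integrable (fun c => M.payB (bS c) (bB v)) G := hE.payB_buyer v hv
      -- A type `w` imitating `v` obtains `u v + (w - v) * x v`, since the payment does not depend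
      -- on the true value.
      have h := hB.2 w hw (bB v)
      refine le_trans (le_of_eq ?_) h
      simp only [ExchangeMechanism.buyerUtility]
      rw [integral_sub (h1.mul_const v) h2, integral_sub (h1.mul_const w) h2,
        integral_mul_const, integral_mul_const]
      ring)
  -- Integrated over both types, the bound reads `E[x] / λ ≤ E[x v] - E[p_B]`: the expected payment
  -- of the buyer is at most the expected virtual value of the traded item.
  rw [← integral_prod_symm _ hX, ← integral_prod_symm
    (fun t : ℝ × ℝ => M.alloc (bS t.1) (bB t.2) * t.2 - M.payB (bS t.1) (bB t.2)) hU,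
    integral_sub hXv hpB, ← div_le_iff₀' hlam] at hbuyer
  have hD : Integrable (fun t : ℝ × ℝ => M.alloc (bS t.1) (bB t.2) * t.2
      - M.alloc (bS t.1) (bB t.2) * t.1) (G.prod F) := hXv.sub hXc
  have hV : Integrable (fun t : ℝ × ℝ => M.alloc (bS t.1) (bB t.2) * (t.2 - (t.1 + 1 / lam)))
      (G.prod F) :=
    (hD.sub (hX.div_const lam)).congr
      (Filter.Eventually.of_forall fun t => by simp only [Pi.sub_apply]; ring)
  have hvirt : ∫ t : ℝ × ℝ, M.alloc (bS t.1) (bB t.2) * (t.2 - (t.1 + 1 / lam)) ∂(G.prod F)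
      = ∫ t : ℝ × ℝ, M.alloc (bS t.1) (bB t.2) * t.2 ∂(G.prod F)
        - ∫ t : ℝ × ℝ, M.alloc (bS t.1) (bB t.2) * t.1 ∂(G.prod F)
        - (∫ t : ℝ × ℝ, M.alloc (bS t.1) (bB t.2) ∂(G.prod F)) / lam := by
    rw [← integral_div, ← integral_sub hXv hXc, ← integral_sub hD (hX.div_const lam)]
    exact integral_congr_ae (Filter.Eventually.of_forall fun t => by ring)
  calc M.revenue ⟨F, Set.Ici 0, G, C⟩ bS bB
      = ∫ t : ℝ × ℝ, M.payB (bS t.1) (bB t.2) ∂(G.prod F)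
        - ∫ t : ℝ × ℝ, M.payS (bS t.1) (bB t.2) ∂(G.prod F) := integral_sub hpB hpS
    _ ≤ ∫ t : ℝ × ℝ, M.alloc (bS t.1) (bB t.2) * (t.2 - (t.1 + 1 / lam)) ∂(G.prod F) := by
        rw [hvirt]; linarith
    _ ≤ _ := by
        refine integral_mono hV (integrable_prod_excess hlam hT hG0 (by positivity)) fun t => ?_
        exact (mul_le_mul_of_nonneg_left (le_max_left _ _) (M.alloc_nonneg _ _)).trans
          (mul_le_of_le_one_left (le_max_right _ _) (M.alloc_le_one _ _))

end FeeSetting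

/-! ### Comparison of the excesses and conclusion. -/

theorem integral_exp_shift {lam : ℝ} (hlam : 0 < lam) (G : Measure ℝ) (a b : ℝ) :
    ∫ c, Real.exp (-lam * (c + a / lam)) / lam ∂G
      = Real.exp (b - a) * ∫ c, Real.exp (-lam * (c + b / lam)) / lam ∂G := by
  rw [← integral_const_mul]
  refine integral_congr_ae (Filter.Eventually.of_forall fun c => ?_)
  simp only
  rw [← mul_div_assoc, ← Real.exp_add]
  congr 2
  field_simp
  ring

theorem mainTheorem7 (lam : ℝ) (hlam : 0 < lam)
    (F : Measure ℝ) [IsProbabilityMeasure F]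
    (hF : ∀ v : ℝ, 0 ≤ v → cdf F v = 1 - Real.exp (-lam * v))
    (G : Measure ℝ) [IsProbabilityMeasure G]
    (C : Set ℝ) (hC : C ⊆ Set.Ici 0) (hG : ∀ᵐ c ∂G, c ∈ C) :
    (∃ P : ℝ → ℝ, IsSellerBNE 1 (1 / lam) ⟨F, Set.Ici 0, G, C⟩ P) ∧
    ∀ P : ℝ → ℝ, IsSellerBNE 1 (1 / lam) ⟨F, Set.Ici 0, G, C⟩ P →
      optSurplus ⟨F, Set.Ici 0, G, C⟩ ≤
        Real.exp 1 ^ 2 * revAPX 1 (1 / lam) ⟨F, Set.Ici 0, G, C⟩ P ∧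
      optRevenue ⟨F, Set.Ici 0, G, C⟩ ≤
        ((Real.exp 1 * revAPX 1 (1 / lam) ⟨F, Set.Ici 0, G, C⟩ P : ℝ) : EReal) := by
  have hT := measure_Ici_of_cdf_eq_exp F hF
  have hG0 : ∀ᵐ c ∂G, 0 ≤ c := hG.mono fun c hc => hC hc
  refine ⟨⟨_, isSellerBNE_add hlam hT hC hG _⟩, fun P hP => ?_⟩
  rw [revAPX_eq_of_isSellerBNE hlam hT hC hG hP]
  constructor
  · rw [optSurplus_eq_integral_excess, integral_prod_excess hlam hT hG0 le_rfl]
    -- The threshold is `c` for efficient trade and `c + 2/λ` in equilibrium.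
    have h := integral_exp_shift hlam G 0 2
    rw [zero_div] at h
    rw [h, ← Real.exp_nat_mul]
    norm_num
  · refine sSup_le ?_
    rintro r ⟨A_S, A_B, M, bS, bB, hE, hB, hI, rfl⟩
    refine EReal.coe_le_coe_iff.2 ((revenue_le_integral_excess hlam hT hC hG M hE hB hI).trans ?_)
    rw [integral_prod_excess hlam hT hG0 (by positivity), integral_exp_shift hlam G 1 2]
    norm_num
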